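/- Let $B>0$ and let $\gamma$ be the operator on the real Hilbert space $L^2[0,B]$ given by $(\gamma f)(\xi)=\int_0^B (x-\xi)^+f(x)\,dx$, with adjoint $\gamma^*$, $(\gamma^* f)(\xi)=\int_0^B(\xi-x)^+f(x)\,dx$. For $g,h\in L^2[0,B]$ we write $\partial^4 g=h$ (and call $g$ four times differentiable) if $g$ has a representative of class $C^3$ on $[0,B]$ whose third derivative is absolutely continuous with derivative $h$ almost everywhere. 1. $\gamma^*\gamma$ and $\gamma\gamma^*$ are the integral operators on $L^2[0,B]$ with kernels $\vartheta_1(\xi,x)=\int_0^B(\xi-u)^+(x-u)^+\,du$ and $\vartheta_2(\xi,x)=\int_0^B(u-\xi)^+(u-x)^+\,du$, which are continuous and symmetric on $[0,B]^2$. Both operators are compact and self-adjoint. There are a strictly decreasing sequence of positive numbers $(\lambda_k)_{k\ge0}$ and orthonormal families $(\phi_k)_{k\ge0}$, $(\psi_k)_{k\ge0}$ in $L^2[0,B]$ with $\gamma^*\gamma\phi_k=\lambda_k^2\phi_k$ and $\gamma\gamma^*\psi_k=\lambda_k^2\psi_k$ for all $k$, such that $\overline{\operatorname{span}}\{\phi_k\}=\overline{\operatorname{Rg}(\gamma^*\gamma)}$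 and $\overline{\operatorname{span}}\{\psi_k\}=\overline{\operatorname{Rg}(\gamma\gamma^*)}$. 2. Every element of $\operatorname{Rg}(\gamma^*\gamma)$ and of $\operatorname{Rg}(\gamma\gamma^*)$ is four times differentiable in the above sense. Moreover, for $f\in L^2[0,B]$, $\gamma^*\gamma f$ has a representative of class $C^4$ on $[0,B]$ if and only if $f$ has a continuous representative, and likewise for $\gamma\gamma^*f$; in particular all $\phi_k$ and $\psi_k$ have representatives of class $C^4$. 3. $\operatorname{Ker}(\gamma^*\gamma)=\operatorname{Ker}(\gamma\gamma^*)=\{0\}$, and $L^2[0,B]=\overline{\operatorname{Rg}(\gamma^*\gamma)}=\overline{\operatorname{span}}\{\phi_k\}=\overline{\operatorname{Rg}(\gamma\gamma^*)}=\overline{\operatorname{span}}\{\psi_k\}$; thus $(\phi_k)$ and $(\psi_k)$ (from part 1) are orthonormal bases of $L^2[0,B]$. 4. $\partial^4$ inverts both operators: for $T\in\{\gamma^*\gamma,\gamma\gamma^*\}$, $\partial^4 Tf=f$ for all $f\in L^2[0,B]$ (and $f$ is the only fourth derivative of $Tf$), and $T\,\partial^4 g=g$ for all $g\in\operatorname{Rg}(T)$.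 5. For all $f\in L^2[0,B]$, with convergence in $L^2[0,B]$, $$f=\sum_{k\ge0}\langle f,\phi_k\rangle\phi_k,\quad \gamma^*\gamma f=\sum_{k\ge0}\lambda_k^2\langle f,\phi_k\rangle\phi_k,\quad f=\sum_{k\ge0}\langle f,\psi_k\rangle\psi_k,\quad \gamma\gamma^*f=\sum_{k\ge0}\lambda_k^2\langle f,\psi_k\rangle\psi_k.$$ -/

import Mathlib

open MeasureTheory Set

/-- Lebesgue measure on the segment `[0, B]`. -/
noncomputable abbrev segMeasure (B : ℝ) : Measure ℝ := volume.restrict (Icc 0 B)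

/-- The real Hilbert space `L²[0, B]`. -/
abbrev L2Seg (B : ℝ) : Type := Lp ℝ 2 (segMeasure B)

/-- The call kernel `θ(ξ, x) = (x - ξ)⁺`. -/
noncomputable def callKernel (ξ x : ℝ) : ℝ := max (x - ξ) 0

/-- The put kernel `θ*(ξ, x) = θ(x, ξ) = (ξ - x)⁺`. -/
noncomputable def putKernel (ξ x : ℝ) : ℝ := callKernel x ξ

/-- The function `ξ ↦ ∫_[0,B] θ(ξ, x) f(x) dx`. -/
noncomputable def callFun (B : ℝ) (f : ℝ → ℝ) (ξ : ℝ) : ℝ :=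
  ∫ x in Icc 0 B, callKernel ξ x * f x

theorem continuous_callKernel : Continuous (fun p : ℝ × ℝ => callKernel p.1 p.2) := by
  unfold callKernel
  fun_prop

theorem abs_callKernel_le {B ξ x : ℝ} (hξ : ξ ∈ Icc 0 B) (hx : x ∈ Icc 0 B) :
    |callKernel ξ x| ≤ |B| := by
  have h0 : 0 ≤ callKernel ξ x := le_max_right _ _
  rw [abs_of_nonneg h0]
  refine max_le ?_ (abs_nonneg B)
  linarith [hξ.1, hx.2, le_abs_self B]

theorem integrable_L2Seg {B : ℝ} (f : L2Seg B) : Integrable f (segMeasure B) :=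
  (Lp.memLp f).integrable (by norm_num)

theorem integrable_callKernel_mul {B : ℝ} (f : L2Seg B) {ξ : ℝ} (hξ : ξ ∈ Icc 0 B) :
    Integrable (fun x => callKernel ξ x * f x) (segMeasure B) := by
  have hc : Continuous (fun x => callKernel ξ x) := by unfold callKernel; fun_prop
  refine (integrable_L2Seg f).bdd_mul (c := |B|) hc.aestronglyMeasurable ?_
  filter_upwards [ae_restrict_mem measurableSet_Icc] with x hx
  exact abs_callKernel_le hξ hx

theorem integral_abs_L2Seg_le {B : ℝ} (f : L2Seg B) :
    ∫ x in Icc 0 B, |f x| ≤ ((segMeasure B univ) ^ ((1 : ℝ) / 2)).toReal * ‖f‖ := by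
  have h := eLpNorm_le_eLpNorm_mul_rpow_measure_univ (μ := segMeasure B) (p := 1) (q := 2)
    (by norm_num) (Lp.memLp f).1
  have hfin : (segMeasure B univ) ^ ((1 : ℝ) / 2) ≠ ⊤ :=
    ENNReal.rpow_ne_top_of_nonneg (by norm_num) (measure_ne_top _ _)
  have e : ∫ x in Icc 0 B, |f x| = (eLpNorm f 1 (segMeasure B)).toReal := by
    rw [eLpNorm_one_eq_lintegral_enorm]
    exact integral_norm_eq_lintegral_enorm (Lp.memLp f).1
  rw [e, Lp.norm_def, mul_comm, ← ENNReal.toReal_mul]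
  refine ENNReal.toReal_mono (ENNReal.mul_ne_top (Lp.memLp f).2.ne hfin) ?_
  convert h using 3
  norm_num

theorem abs_callFun_le {B : ℝ} (f : L2Seg B) {ξ : ℝ} (hξ : ξ ∈ Icc 0 B) :
    |callFun B f ξ| ≤ |B| * (((segMeasure B univ) ^ ((1 : ℝ) / 2)).toReal * ‖f‖) := by
  calc |callFun B f ξ| ≤ ∫ x in Icc 0 B, |callKernel ξ x * f x| := abs_integral_le_integral_abs
    _ ≤ ∫ x in Icc 0 B, |B| * |f x| := by
        refine setIntegral_mono_on (integrable_callKernel_mul f hξ).abs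
          ((integrable_L2Seg f).abs.const_mul _) measurableSet_Icc (fun x hx => ?_)
        rw [abs_mul]
        exact mul_le_mul_of_nonneg_right (abs_callKernel_le hξ hx) (abs_nonneg _)
    _ = |B| * ∫ x in Icc 0 B, |f x| := integral_const_mul _ _
    _ ≤ _ := mul_le_mul_of_nonneg_left (integral_abs_L2Seg_le f) (abs_nonneg _)

theorem memLp_callFun {B : ℝ} (f : L2Seg B) : MemLp (callFun B f) 2 (segMeasure B) := by
  have hm : AEStronglyMeasurable (callFun B f) (segMeasure B) := by
    have h : AEStronglyMeasurable (fun p : ℝ × ℝ => callKernel p.1 p.2 * f p.2)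
        ((segMeasure B).prod (segMeasure B)) :=
      continuous_callKernel.aestronglyMeasurable.mul (Lp.memLp f).1.comp_snd
    exact h.integral_prod_right'
  refine MemLp.of_bound hm
    (|B| * (((segMeasure B univ) ^ ((1 : ℝ) / 2)).toReal * ‖f‖)) ?_
  filter_upwards [ae_restrict_mem measurableSet_Icc] with ξ hξ
  exact abs_callFun_le f hξ

/-- The restricted call operator `γ` on `L²[0, B]`,
`(γ f)(ξ) = ∫_[0,B] (x - ξ)⁺ f(x) dx`. -/
noncomputable def callOp (B : ℝ) : L2Seg B →L[ℝ] L2Seg B :=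
  LinearMap.mkContinuous
    { toFun := fun f => (memLp_callFun f).toLp (callFun B f)
      map_add' := by
        intro f g
        rw [← MemLp.toLp_add]
        refine MemLp.toLp_congr _ _ ?_
        filter_upwards [ae_restrict_mem measurableSet_Icc] with ξ hξ
        rw [Pi.add_apply, callFun, callFun, callFun,
          ← integral_add (integrable_callKernel_mul f hξ) (integrable_callKernel_mul g hξ)]
        refine integral_congr_ae ?_
        filter_upwards [Lp.coeFn_add f g] with x hx
        rw [hx, Pi.add_apply, mul_add]
      map_smul' := by
        intro c f
        rw [RingHom.id_apply, ← MemLp.toLp_const_smul]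
        refine MemLp.toLp_congr _ _ (Filter.Eventually.of_forall fun ξ => ?_)
        rw [Pi.smul_apply, callFun, callFun, smul_eq_mul, ← integral_const_mul]
        refine integral_congr_ae ?_
        filter_upwards [Lp.coeFn_smul c f] with x hx
        rw [hx, Pi.smul_apply, smul_eq_mul]
        ring }
    ((measureUnivNNReal (segMeasure B) : ℝ) ^ (2 : ENNReal).toReal⁻¹ *
      (|B| * ((segMeasure B univ) ^ ((1 : ℝ) / 2)).toReal))
    (by
      intro f
      refine (Lp.norm_le_of_ae_bound
        (C := |B| * (((segMeasure B univ) ^ ((1 : ℝ) / 2)).toReal * ‖f‖)) (by positivity) ?_).trans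
        (le_of_eq (by ring))
      filter_upwards [(memLp_callFun f).coeFn_toLp, ae_restrict_mem measurableSet_Icc] with ξ h hξ
      change ‖((memLp_callFun f).toLp (callFun B f)) ξ‖ ≤ _
      rw [h]
      exact abs_callFun_le f hξ)

theorem callOp_ae_eq {B : ℝ} (f : L2Seg B) :
    callOp B f =ᵐ[segMeasure B] fun ξ => ∫ x in Icc 0 B, callKernel ξ x * f x :=
  (memLp_callFun f).coeFn_toLp

/-- The restricted put operator `γ*`, the adjoint of `γ`. -/
noncomputable def putOp (B : ℝ) : L2Seg B →L[ℝ] L2Seg B :=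
  ContinuousLinearMap.adjoint (callOp B)

/-- The operator `γ*γ`. -/
noncomputable def putCallOp (B : ℝ) : L2Seg B →L[ℝ] L2Seg B := putOp B ∘L callOp B

/-- The operator `γγ*`. -/
noncomputable def callPutOp (B : ℝ) : L2Seg B →L[ℝ] L2Seg B := callOp B ∘L putOp B

/-- The kernel `ϑ₁(ξ, x) = ∫_[0,B] θ*(ξ, u) θ(u, x) du` of `γ*γ`. -/
noncomputable def putCallKernel (B ξ x : ℝ) : ℝ :=
  ∫ u in Icc 0 B, putKernel ξ u * callKernel u x

/-- The kernel `ϑ₂(ξ, x) = ∫_[0,B] θ(ξ, u) θ*(u, x) du` of `γγ*`. -/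
noncomputable def callPutKernel (B ξ x : ℝ) : ℝ :=
  ∫ u in Icc 0 B, callKernel ξ u * putKernel u x

/-- `HasFourthDeriv B g h`: the element `g` of `L²[0, B]` is four times differentiable with fourth
derivative `∂⁴ g = h ∈ L²[0, B]`. That is, `g` has a representative of class `C³` on `[0, B]` whose
third derivative is absolutely continuous on `[0, B]` and has derivative `h` almost everywhere.
(One-sided derivatives are used at the end points.) -/
def HasFourthDeriv (B : ℝ) (g h : L2Seg B) : Prop :=
  ∃ G : ℝ → ℝ, g =ᵐ[segMeasure B] G ∧
    ContDiffOn ℝ 3 G (Icc 0 B) ∧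
    AbsolutelyContinuousOnInterval (iteratedDerivWithin 3 G (Icc 0 B)) 0 B ∧
    ∀ᵐ x ∂(segMeasure B),
      HasDerivWithinAt (iteratedDerivWithin 3 G (Icc 0 B)) (h x) (Icc 0 B) x

/-- The element `g` of `L²[0, B]` has a representative that is classically `C^n` on `[0, B]`. -/
def HasContDiffRep (B : ℝ) (n : ℕ) (g : L2Seg B) : Prop :=
  ∃ G : ℝ → ℝ, g =ᵐ[segMeasure B] G ∧ ContDiffOn ℝ n G (Icc 0 B)

/-! Differentiating the explicit formula for `γ*γ f` gives `u' = ∫₀^ξ γf`, `u'' = γf`, `u''' =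
-∫_ξ^B f`. So the third derivative is a constant plus an indefinite integral of `f`, and `∂⁴` undoes
`γ*γ`; the same holds for `γγ*`. Hence both kernels are trivial, and by self-adjointness both ranges
are dense. Compactness holds because `γ` is a norm limit of finite rank operators.

The compact spectral theorem then gives a complete set of eigenvectors. A strictly decreasing
sequence of eigenvalues requires in addition that every eigenvalue be simple. For `γ*γ f = μ f`, the
function `u = γ*γ f` solves the clamped-free beam problem `μ u'''' = u`, `u(0) = u'(0) = 0`, `u''(B)
= u'''(B) = 0`. A Pohozaev-type identity, with multiplier `t u'`, shows that `u(B) = 0` forces `u =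
0` (`eq_zero_of_putCallOp_eigenvector`). So an eigenvector is determined by the single number
`u(B)`, and eigenspaces are lines.

The second family is `ψ_k = λ_k⁻¹ γ φ_k`. It inherits orthonormality from `⟨γf, γg⟩ = ⟨γ*γ f, g⟩`
and completeness from the injectivity of `γ*`. -/

/-! ### Enumerating positive reals that accumulate only at zero -/

theorem exists_strictAnti_range_eq {S : Set ℝ} (hinf : S.Infinite) (hpos : ∀ s ∈ S, 0 < s)
    (hfin : ∀ ε > 0, {s ∈ S | ε ≤ s}.Finite) : ∃ μ : ℕ → ℝ, StrictAnti μ ∧ range μ = S := by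
  classical
  have hinf' : Infinite S := hinf.to_subtype
  -- With the order reversed, `S` is locally finite, has a bottom and has no maximum, so it is order
  -- isomorphic to `ℕ`.
  have hIcc : ∀ a b : Sᵒᵈ, (Set.Icc a b).Finite := by
    intro a b
    refine Set.Finite.of_finite_image (f := fun x : Sᵒᵈ => ((OrderDual.ofDual x : S) : ℝ))
      ((hfin _ (hpos _ (OrderDual.ofDual b).2)).subset ?_) ?_
    · rintro _ ⟨x, hx, rfl⟩
      exact ⟨(OrderDual.ofDual x).2, hx.2⟩
    · exact (Subtype.val_injective.comp OrderDual.ofDual.injective).injOn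
  obtain ⟨a, ha⟩ := hinf.nonempty
  obtain ⟨m, hm, hmax⟩ := (hfin a (hpos a ha)).exists_maximal ⟨a, ha, le_refl a⟩
  have hmS : ∀ s ∈ S, s ≤ m := by
    intro s hs
    by_contra! h
    exact absurd (hmax ⟨hs, hm.2.trans h.le⟩ h.le) (not_le.2 h)
  let _ : LocallyFiniteOrder Sᵒᵈ := LocallyFiniteOrder.ofFiniteIcc hIcc
  let _ : OrderBot Sᵒᵈ :=
    { bot := OrderDual.toDual ⟨m, hm.1⟩
      bot_le := fun x => hmS _ (OrderDual.ofDual x).2 }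
  have _ : NoMaxOrder Sᵒᵈ := by
    refine ⟨fun x => ?_⟩
    by_contra! h
    refine hinf ((hfin _ (hpos _ (OrderDual.ofDual x).2)).subset fun s hs => ⟨hs, ?_⟩)
    exact h (OrderDual.toDual ⟨s, hs⟩)
  let _ : SuccOrder Sᵒᵈ := LinearLocallyFiniteOrder.succOrder _
  let _ : PredOrder Sᵒᵈ := LinearLocallyFiniteOrder.predOrder _
  let e : Sᵒᵈ ≃o ℕ := orderIsoNatOfLinearSuccPredArch
  refine ⟨fun n => ((OrderDual.ofDual (e.symm n) : S) : ℝ), fun i j hij => ?_, ?_⟩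
  · exact e.symm.strictMono hij
  · ext s
    constructor
    · rintro ⟨n, rfl⟩
      exact (OrderDual.ofDual (e.symm n)).2
    · intro hs
      exact ⟨e (OrderDual.toDual ⟨s, hs⟩), by simp⟩

/-! ### Compact symmetric operators with simple spectrum -/

section Spectral

variable {H : Type*} [NormedAddCommGroup H] [InnerProductSpace ℝ H]

/-- Unit eigenvectors for distinct eigenvalues are orthogonal, so by Pythagoras their images lie at
distance at least `ε`; infinitely many of them would have no convergent subsequence of images. -/
theorem IsCompactOperator.finite_setOf_le_hasEigenvalue {T : H →L[ℝ] H} (hT : IsCompactOperator T)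
    (hs : (T : H →ₗ[ℝ] H).IsSymmetric) {ε : ℝ} (hε : 0 < ε) :
    {μ : ℝ | Module.End.HasEigenvalue (T : Module.End ℝ H) μ ∧ ε ≤ μ}.Finite := by
  by_contra hinf
  have hinf : Set.Infinite _ := hinf
  let ν : ℕ → ℝ := fun n => (hinf.natEmbedding _ n : ℝ)
  have hν : Function.Injective ν := Subtype.val_injective.comp (hinf.natEmbedding _).injective
  have hmem : ∀ n, Module.End.HasEigenvalue (T : Module.End ℝ H) (ν n) ∧ ε ≤ ν n :=
    fun n => (hinf.natEmbedding _ n).2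
  have hv : ∀ n, ∃ v : H, ‖v‖ = 1 ∧ T v = ν n • v := by
    intro n
    obtain ⟨v, hv, hv0⟩ := (hmem n).1.exists_hasEigenvector
    refine ⟨‖v‖⁻¹ • v, norm_smul_inv_norm hv0, ?_⟩
    rw [map_smul, smul_comm]
    congr 1
    simpa using Module.End.mem_eigenspace_iff.1 hv
  choose v hv1 hTv using hv
  have hK := hT.isCompact_closure_image_closedBall (f := (T : H →ₗ[ℝ] H)) 1
  obtain ⟨a, -, g, hg, hlim⟩ := hK.tendsto_subseq (x := fun n => T (v n))
    (fun n => subset_closure ⟨v n, by simp [hv1], rfl⟩)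
  have hc := hlim.cauchySeq
  rw [Metric.cauchySeq_iff] at hc
  obtain ⟨N, hN⟩ := hc ε hε
  have hd := hN N le_rfl (N + 1) (Nat.le_succ N)
  have hne : ν (g N) ≠ ν (g (N + 1)) := fun h => (hg (Nat.lt_succ_self N)).ne (hν h)
  have horth : inner ℝ (v (g N)) (v (g (N + 1))) = 0 := by
    have h := hs (v (g N)) (v (g (N + 1)))
    simp only [ContinuousLinearMap.coe_coe, hTv, inner_smul_left, inner_smul_right] at h
    have : (ν (g N) - ν (g (N + 1))) * inner ℝ (v (g N)) (v (g (N + 1))) = 0 := by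
      simp only [RCLike.conj_to_real] at h
      linarith
    exact (mul_eq_zero.1 this).resolve_left (sub_ne_zero.2 hne)
  have hn : ‖T (v (g N)) - T (v (g (N + 1)))‖ ^ 2 = ν (g N) ^ 2 + ν (g (N + 1)) ^ 2 := by
    rw [hTv, hTv, norm_sub_sq_real, inner_smul_left, inner_smul_right, horth, norm_smul, norm_smul,
      hv1, hv1]
    simp
  rw [Function.comp, Function.comp, dist_eq_norm] at hd
  have h1 := (hmem (g N)).2
  have h3 : ‖T (v (g N)) - T (v (g (N + 1)))‖ ^ 2 < ε ^ 2 :=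
    pow_lt_pow_left₀ hd (norm_nonneg _) (by norm_num)
  nlinarith [sq_nonneg (ν (g (N + 1)))]

variable [CompleteSpace H]

/-- By simplicity, one unit vector per eigenvalue spans the whole eigenspace, so indexing by
eigenvalues loses nothing and the sequence can be strictly decreasing. -/
theorem exists_orthonormal_eigenvectors {T : H →L[ℝ] H} (hT : IsCompactOperator T)
    (hs : (T : H →ₗ[ℝ] H).IsSymmetric) (hpos : ∀ x ≠ 0, 0 < inner ℝ (T x) x)
    (hsimple : ∀ (μ : ℝ) (x y : H), x ≠ 0 → T x = μ • x → T y = μ • y → ∃ c : ℝ, y = c • x)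
    (hdim : ¬ FiniteDimensional ℝ H) :
    ∃ (μ : ℕ → ℝ) (φ : ℕ → H), (∀ k, 0 < μ k) ∧ StrictAnti μ ∧ Orthonormal ℝ φ ∧
      (∀ k, T (φ k) = μ k • φ k) ∧ (Submodule.span ℝ (range φ)).topologicalClosure = ⊤ := by
  let S : Set ℝ := {μ | Module.End.HasEigenvalue (T : Module.End ℝ H) μ}
  have hv : ∀ μ : S, ∃ v : H, ‖v‖ = 1 ∧ T v = (μ : ℝ) • v := by
    intro μ
    obtain ⟨v, hv, hv0⟩ := Module.End.HasEigenvalue.exists_hasEigenvector μ.2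
    refine ⟨‖v‖⁻¹ • v, norm_smul_inv_norm hv0, ?_⟩
    rw [map_smul, smul_comm]
    congr 1
    simpa using Module.End.mem_eigenspace_iff.1 hv
  choose v hv1 hTv using hv
  have hv0 : ∀ μ, v μ ≠ 0 := fun μ h => by simpa [h] using hv1 μ
  have hSpos : ∀ μ ∈ S, 0 < μ := by
    intro μ hμ
    have h := hpos _ (hv0 ⟨μ, hμ⟩)
    rw [hTv, inner_smul_left, real_inner_self_eq_norm_sq, hv1] at h
    simpa using h
  have hspan : (Submodule.span ℝ (range v)).topologicalClosure = ⊤ := by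
    rw [Submodule.topologicalClosure_eq_top_iff, Submodule.eq_bot_iff]
    intro x hx
    have h0 := ContinuousLinearMap.orthogonalComplement_iSup_eigenspaces_eq_bot hT hs
    rw [Submodule.eq_bot_iff] at h0
    refine h0 x (Submodule.orthogonal_le (iSup_le fun μ y hy => ?_) hx)
    have hTy : T y = μ • y := by simpa using Module.End.mem_eigenspace_iff.1 hy
    by_cases hy0 : y = 0
    · rw [hy0]; exact Submodule.zero_mem _
    have hμ : μ ∈ S := Module.End.hasEigenvalue_of_hasEigenvector ⟨hy, hy0⟩
    obtain ⟨c, rfl⟩ := hsimple μ (v ⟨μ, hμ⟩) y (hv0 _) (hTv _) hTy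
    exact Submodule.smul_mem _ _ (Submodule.subset_span ⟨_, rfl⟩)
  -- A finite spectrum would make the dense span finite-dimensional, hence closed, hence all of `H`.
  have hSinf : S.Infinite := by
    intro hfin
    refine hdim ?_
    have : Finite S := hfin
    have hfd : FiniteDimensional ℝ (Submodule.span ℝ (range v)) :=
      FiniteDimensional.span_of_finite ℝ (finite_range v)
    have hcl : (Submodule.span ℝ (range v)).topologicalClosure = Submodule.span ℝ (range v) :=
      (Submodule.closed_of_finiteDimensional _).submodule_topologicalClosure_eq
    rw [hcl] at hspan
    rw [hspan] at hfd
    exact Module.Finite.equiv (Submodule.topEquiv (R := ℝ) (M := H))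
  obtain ⟨μ, hμ, hr⟩ := exists_strictAnti_range_eq hSinf hSpos
    (fun ε hε => hT.finite_setOf_le_hasEigenvalue hs hε)
  have hμS : ∀ k, μ k ∈ S := fun k => hr ▸ mem_range_self k
  refine ⟨μ, fun k => v ⟨μ k, hμS k⟩, fun k => hSpos _ (hμS k), hμ, ⟨fun k => hv1 _, ?_⟩,
    fun k => hTv _, ?_⟩
  · intro i j hij
    have h := hs (v ⟨μ i, hμS i⟩) (v ⟨μ j, hμS j⟩)
    simp only [ContinuousLinearMap.coe_coe, hTv, inner_smul_left, inner_smul_right,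
      RCLike.conj_to_real] at h
    have : (μ i - μ j) * inner ℝ (v ⟨μ i, hμS i⟩) (v ⟨μ j, hμS j⟩) = 0 := by linarith
    exact (mul_eq_zero.1 this).resolve_left (sub_ne_zero.2 fun h => hij (hμ.injective h))
  · convert hspan using 3
    ext x
    constructor
    · rintro ⟨k, rfl⟩
      exact ⟨_, rfl⟩
    · rintro ⟨⟨s, hs'⟩, rfl⟩
      obtain ⟨k, hk⟩ : s ∈ range μ := hr ▸ hs'
      subst hk
      exact ⟨k, rfl⟩

theorem Orthonormal.hasSum_inner_smul {φ : ℕ → H} (hφ : Orthonormal ℝ φ)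
    (hd : (Submodule.span ℝ (range φ)).topologicalClosure = ⊤) (f : H) :
    HasSum (fun k => inner ℝ f (φ k) • φ k) f := by
  have h := (HilbertBasis.mk hφ hd.ge).hasSum_repr f
  simpa only [HilbertBasis.repr_apply_apply, HilbertBasis.coe_mk, real_inner_comm] using h

theorem Orthonormal.hasSum_eigenvector_expansion {φ : ℕ → H} (hφ : Orthonormal ℝ φ)
    (hd : (Submodule.span ℝ (range φ)).topologicalClosure = ⊤) {T : H →L[ℝ] H} {μ : ℕ → ℝ}
    (hT : ∀ k, T (φ k) = μ k • φ k) (f : H) :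
    HasSum (fun k => (μ k * inner ℝ f (φ k)) • φ k) (T f) := by
  convert! (hφ.hasSum_inner_smul hd f).mapL T using 2 with k
  rw [map_smul, hT, smul_smul, mul_comm]

end Spectral

/-! ### Integral kernels of the adjoint and of the compositions -/

section Kernel

variable {B : ℝ} {k k' : ℝ → ℝ → ℝ}

theorem continuous_putKernel : Continuous (Function.uncurry putKernel) := by
  unfold putKernel callKernel Function.uncurry
  fun_prop

theorem continuous_uncurry_callKernel : Continuous (Function.uncurry callKernel) :=
  continuous_callKernel

theorem exists_bound_kernel (B : ℝ) (hk : Continuous (Function.uncurry k)) :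
    ∃ C, 0 ≤ C ∧ ∀ ξ ∈ Icc 0 B, ∀ x ∈ Icc 0 B, |k ξ x| ≤ C := by
  obtain ⟨C, hC⟩ := (isCompact_Icc.prod isCompact_Icc).exists_bound_of_continuousOn
    (s := Icc (0 : ℝ) B ×ˢ Icc (0 : ℝ) B) hk.continuousOn
  exact ⟨|C|, abs_nonneg C, fun ξ hξ x hx => (hC (ξ, x) ⟨hξ, hx⟩).trans (le_abs_self C)⟩

theorem integrable_mul_kernel_mul (hk : Continuous (Function.uncurry k)) {f g : ℝ → ℝ}
    (hf : Integrable f (segMeasure B)) (hg : Integrable g (segMeasure B)) :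
    Integrable (fun p : ℝ × ℝ => k p.1 p.2 * (g p.1 * f p.2))
      ((segMeasure B).prod (segMeasure B)) := by
  obtain ⟨C, -, hC⟩ := exists_bound_kernel B hk
  refine (hg.mul_prod hf).bdd_mul (c := C) hk.aestronglyMeasurable ?_
  rw [Measure.prod_restrict]
  filter_upwards [ae_restrict_mem (measurableSet_Icc.prod measurableSet_Icc)] with p hp
  exact hC _ hp.1 _ hp.2

theorem integrable_kernel_mul (hk : Continuous (Function.uncurry k)) {f : ℝ → ℝ}
    (hf : Integrable f (segMeasure B)) {ξ : ℝ} :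
    Integrable (fun x => k ξ x * f x) (segMeasure B) := by
  have hc : Continuous (k ξ) := hk.comp (by fun_prop : Continuous fun x : ℝ => (ξ, x))
  obtain ⟨C, hC⟩ := isCompact_Icc.exists_bound_of_continuousOn (s := Icc (0 : ℝ) B) hc.continuousOn
  refine hf.bdd_mul (c := C) hc.aestronglyMeasurable ?_
  filter_upwards [ae_restrict_mem measurableSet_Icc] with x hx
  exact hC x hx

theorem memLp_integral_kernel_mul (hk : Continuous (Function.uncurry k)) {f : ℝ → ℝ}
    (hf : Integrable f (segMeasure B)) :
    MemLp (fun ξ => ∫ x in Icc 0 B, k ξ x * f x) 2 (segMeasure B) := by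
  obtain ⟨C, -, hC⟩ := exists_bound_kernel B hk
  have h := integrable_mul_kernel_mul hk hf (integrable_const (1 : ℝ))
  have hm := h.aestronglyMeasurable.integral_prod_right'
  simp only [one_mul] at hm
  refine MemLp.of_bound hm (∫ x in Icc 0 B, C * |f x|) ?_
  filter_upwards [ae_restrict_mem measurableSet_Icc] with ξ hξ
  refine norm_integral_le_of_norm_le (hf.abs.const_mul C) ?_
  filter_upwards [ae_restrict_mem measurableSet_Icc] with x hx
  rw [norm_mul]
  exact mul_le_mul_of_nonneg_right (hC ξ hξ x hx) (abs_nonneg _)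

theorem inner_L2Seg (f g : L2Seg B) : inner ℝ f g = ∫ x in Icc 0 B, f x * g x := by
  rw [L2.inner_def]
  simp [mul_comm]

theorem integral_kernel_comp (hk : Continuous (Function.uncurry k))
    (hk' : Continuous (Function.uncurry k')) {f : ℝ → ℝ} (hf : Integrable f (segMeasure B))
    (ξ : ℝ) :
    ∫ u in Icc 0 B, k ξ u * ∫ x in Icc 0 B, k' u x * f x =
      ∫ x in Icc 0 B, (∫ u in Icc 0 B, k ξ u * k' u x) * f x := by
  have hc : Continuous (k ξ) := hk.comp (by fun_prop : Continuous fun x : ℝ => (ξ, x))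
  have h := integrable_mul_kernel_mul hk' hf
    (hc.continuousOn.integrableOn_compact (μ := volume) (isCompact_Icc (a := 0) (b := B)))
  calc _ = ∫ u in Icc 0 B, ∫ x in Icc 0 B, k' u x * (k ξ u * f x) := by
        simp only [← integral_const_mul]
        congr! 4
        ring
    _ = ∫ x in Icc 0 B, ∫ u in Icc 0 B, k' u x * (k ξ u * f x) := integral_integral_swap h
    _ = _ := by
        simp only [← integral_mul_const]
        congr! 4
        ring

/-- The adjoint is identified by testing against an arbitrary `g` and exchanging the integrals. -/
theorem putOp_ae_eq (f : L2Seg B) :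
    putOp B f =ᵐ[segMeasure B] fun ξ => ∫ x in Icc 0 B, putKernel ξ x * f x := by
  have hm := memLp_integral_kernel_mul continuous_putKernel (integrable_L2Seg f)
  have h : putOp B f = hm.toLp _ := by
    refine ext_inner_right ℝ fun g => ?_
    rw [putOp, ContinuousLinearMap.adjoint_inner_left, inner_L2Seg, inner_L2Seg]
    have hi := integrable_mul_kernel_mul continuous_uncurry_callKernel (integrable_L2Seg g)
      (integrable_L2Seg f)
    calc _ = ∫ u in Icc 0 B, ∫ x in Icc 0 B, callKernel u x * (f u * g x) := by
          refine integral_congr_ae ?_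
          filter_upwards [callOp_ae_eq g] with u hu
          rw [hu, ← integral_const_mul]
          congr! 2
          ring
      _ = ∫ x in Icc 0 B, ∫ u in Icc 0 B, callKernel u x * (f u * g x) :=
          integral_integral_swap hi
      _ = _ := by
          refine integral_congr_ae ?_
          filter_upwards [hm.coeFn_toLp] with x hx
          rw [hx, ← integral_mul_const]
          congr! 2
          rw [putKernel]
          ring
  rw [h]
  exact hm.coeFn_toLp

theorem putCallOp_ae_eq_putFun (f : L2Seg B) : putCallOp B f =ᵐ[segMeasure B]
    fun ξ => ∫ u in Icc 0 B, putKernel ξ u * ∫ x in Icc 0 B, callKernel u x * f x := by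
  filter_upwards [putOp_ae_eq (callOp B f)] with ξ hξ
  refine hξ.trans (integral_congr_ae ?_)
  filter_upwards [callOp_ae_eq f] with u hu
  rw [hu]

theorem callPutOp_ae_eq_callFun (f : L2Seg B) : callPutOp B f =ᵐ[segMeasure B]
    fun ξ => ∫ u in Icc 0 B, callKernel ξ u * ∫ x in Icc 0 B, putKernel u x * f x := by
  filter_upwards [callOp_ae_eq (putOp B f)] with ξ hξ
  refine hξ.trans (integral_congr_ae ?_)
  filter_upwards [putOp_ae_eq f] with u hu
  rw [hu]

theorem putCallOp_ae_eq (f : L2Seg B) : putCallOp B f =ᵐ[segMeasure B]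
    fun ξ => ∫ x in Icc 0 B, putCallKernel B ξ x * f x := by
  filter_upwards [putCallOp_ae_eq_putFun f] with ξ hξ
  rw [hξ]
  exact integral_kernel_comp continuous_putKernel continuous_uncurry_callKernel
    (integrable_L2Seg f) ξ

theorem callPutOp_ae_eq (f : L2Seg B) : callPutOp B f =ᵐ[segMeasure B]
    fun ξ => ∫ x in Icc 0 B, callPutKernel B ξ x * f x := by
  filter_upwards [callPutOp_ae_eq_callFun f] with ξ hξ
  rw [hξ]
  exact integral_kernel_comp continuous_uncurry_callKernel continuous_putKernel
    (integrable_L2Seg f) ξ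

theorem continuous_putCallKernel (B : ℝ) :
    Continuous (fun p : ℝ × ℝ => putCallKernel B p.1 p.2) := by
  unfold putCallKernel putKernel callKernel
  exact continuous_parametric_integral_of_continuous
    (f := fun (p : ℝ × ℝ) u => max (p.1 - u) 0 * max (p.2 - u) 0) (by fun_prop) isCompact_Icc

theorem continuous_callPutKernel (B : ℝ) :
    Continuous (fun p : ℝ × ℝ => callPutKernel B p.1 p.2) := by
  unfold callPutKernel putKernel callKernel
  exact continuous_parametric_integral_of_continuous
    (f := fun (p : ℝ × ℝ) u => max (u - p.1) 0 * max (u - p.2) 0) (by fun_prop) isCompact_Icc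

theorem putCallKernel_comm (B ξ x : ℝ) : putCallKernel B ξ x = putCallKernel B x ξ := by
  simp only [putCallKernel, putKernel, mul_comm]

theorem callPutKernel_comm (B ξ x : ℝ) : callPutKernel B ξ x = callPutKernel B x ξ := by
  simp only [callPutKernel, putKernel, mul_comm]

theorem isSelfAdjoint_putCallOp (B : ℝ) : IsSelfAdjoint (putCallOp B) := by
  rw [ContinuousLinearMap.isSelfAdjoint_iff', putCallOp, ContinuousLinearMap.adjoint_comp, putOp,
    ContinuousLinearMap.adjoint_adjoint]

theorem isSelfAdjoint_callPutOp (B : ℝ) : IsSelfAdjoint (callPutOp B) := by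
  rw [ContinuousLinearMap.isSelfAdjoint_iff', callPutOp, ContinuousLinearMap.adjoint_comp, putOp,
    ContinuousLinearMap.adjoint_adjoint]

theorem inner_putCallOp_left (f g : L2Seg B) :
    inner ℝ (putCallOp B f) g = inner ℝ (callOp B f) (callOp B g) := by
  rw [putCallOp, putOp, ContinuousLinearMap.comp_apply, ContinuousLinearMap.adjoint_inner_left]

end Kernel

/-! ### Compactness by finite rank approximation -/

open Filter Topology

theorem MeasureTheory.Lp.coeFn_sum_ae {α ι : Type*} {m : MeasurableSpace α} {μ : Measure α}
    {p : ENNReal} (s : Finset ι) (F : ι → Lp ℝ p μ) :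
    (∑ i ∈ s, F i : Lp ℝ p μ) =ᵐ[μ] fun x => ∑ i ∈ s, F i x := by
  classical
  induction s using Finset.induction_on with
  | empty =>
    simp only [Finset.sum_empty]
    exact Lp.coeFn_zero ℝ p μ
  | insert a s ha ih =>
    rw [Finset.sum_insert ha]
    filter_upwards [Lp.coeFn_add (F a) (∑ i ∈ s, F i), ih] with x h1 h2
    rw [h1, Finset.sum_insert ha, Pi.add_apply, h2]

section Compact

variable {B : ℝ}

theorem memLp_of_continuous (B : ℝ) {g : ℝ → ℝ} (hg : Continuous g) :
    MemLp g 2 (segMeasure B) := by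
  obtain ⟨C, hC⟩ := isCompact_Icc.exists_bound_of_continuousOn (s := Icc (0 : ℝ) B) hg.continuousOn
  refine MemLp.of_bound hg.aestronglyMeasurable C ?_
  filter_upwards [ae_restrict_mem measurableSet_Icc] with x hx
  exact hC x hx

theorem memLp_callKernel (B ξ : ℝ) : MemLp (callKernel ξ) 2 (segMeasure B) :=
  memLp_of_continuous B (by unfold callKernel; fun_prop)

theorem abs_callKernel_sub_le (ξ ξ' x : ℝ) :
    |callKernel ξ x - callKernel ξ' x| ≤ |ξ - ξ'| := by
  refine (abs_max_sub_max_le_abs _ _ _).trans (le_of_eq ?_)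
  rw [abs_sub_comm ξ]
  congr 1
  ring

/-- The finite rank operator sampling the call kernel on the grid of mesh `δ` in its first
variable. -/
noncomputable def sampledCallOp (B δ : ℝ) : L2Seg B →L[ℝ] L2Seg B :=
  ∑ i ∈ Finset.range (⌊B / δ⌋₊ + 1),
    (innerSL ℝ ((memLp_callKernel B (i * δ)).toLp _)).smulRight
      (indicatorConstLp 2 (μ := segMeasure B) (s := (fun ξ : ℝ => ⌊ξ / δ⌋₊) ⁻¹' {i})
        ((Nat.measurable_floor.comp (measurable_id.div_const δ)) (measurableSet_singleton i))
        (measure_ne_top _ _) (1 : ℝ))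

theorem isCompactOperator_sampledCallOp (B δ : ℝ) : IsCompactOperator (sampledCallOp B δ) := by
  refine Submodule.sum_mem (compactOperator (RingHom.id ℝ) (L2Seg B) (L2Seg B))
    (fun i _ => ?_)
  -- Each summand has rank at most one: it factors through `ℝ`.
  exact IsCompactOperator.clm_comp (f := innerSL ℝ ((memLp_callKernel B (i * δ)).toLp _))
    (isCompactOperator_of_locallyCompactSpace_dom _)
    ((ContinuousLinearMap.id ℝ ℝ).smulRight _)

theorem sampledCallOp_ae_eq {δ : ℝ} (hδ : 0 < δ) (f : L2Seg B) :
    sampledCallOp B δ f =ᵐ[segMeasure B]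
      fun ξ => ∫ x in Icc 0 B, callKernel (⌊ξ / δ⌋₊ * δ) x * f x := by
  have hin : ∀ i : ℕ, inner ℝ ((memLp_callKernel B (i * δ)).toLp _) f =
      ∫ x in Icc 0 B, callKernel (i * δ) x * f x := by
    intro i
    rw [inner_L2Seg]
    refine integral_congr_ae ?_
    filter_upwards [(memLp_callKernel B (i * δ)).coeFn_toLp] with x hx
    rw [hx]
  rw [sampledCallOp, sum_apply]
  refine (Lp.coeFn_sum_ae _ _).trans ?_
  have hall : ∀ᵐ ξ ∂(segMeasure B), ∀ i : ℕ,
      (inner ℝ ((memLp_callKernel B (i * δ)).toLp _) f •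
        indicatorConstLp 2 (μ := segMeasure B) (s := (fun ξ : ℝ => ⌊ξ / δ⌋₊) ⁻¹' {i})
        ((Nat.measurable_floor.comp (measurable_id.div_const δ)) (measurableSet_singleton i))
        (measure_ne_top _ _) (1 : ℝ) : L2Seg B) ξ =
      (∫ x in Icc 0 B, callKernel (i * δ) x * f x) * if ⌊ξ / δ⌋₊ = i then 1 else 0 := by
    rw [ae_all_iff]
    intro i
    refine (Lp.coeFn_smul _ _).trans ?_
    filter_upwards [indicatorConstLp_coeFn (p := 2) (μ := segMeasure B)
      (hs := (Nat.measurable_floor.comp (measurable_id.div_const δ)) (measurableSet_singleton i))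
      (hμs := measure_ne_top _ _) (c := (1 : ℝ))] with ξ hξ
    rw [Pi.smul_apply, smul_eq_mul, hin, hξ]
    congr 1
    by_cases hi : ⌊ξ / δ⌋₊ = i
    · rw [if_pos hi, Set.indicator_of_mem (by exact hi)]
    · rw [if_neg hi, Set.indicator_of_notMem (by exact hi)]
  filter_upwards [hall, ae_restrict_mem measurableSet_Icc] with ξ hξ hm
  simp only [ContinuousLinearMap.smulRight_apply, innerSL_apply_apply, hξ]
  -- Only the index `⌊ξ / δ⌋₊` contributes; the `+ 1` in the range of summation keeps it available
  -- up to `ξ = B`.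
  have hle : ⌊ξ / δ⌋₊ ≤ ⌊B / δ⌋₊ := Nat.floor_mono (div_le_div_of_nonneg_right hm.2 hδ.le)
  simp [hle]

/-- The kernel is 1-Lipschitz in its first variable and rounding moves `ξ` by at most `δ`, so the
error is at most `δ` times the `L¹` norm of `f`. -/
theorem norm_callOp_sub_sampledCallOp_le (B : ℝ) : ∃ K, ∀ δ > 0,
    ‖callOp B - sampledCallOp B δ‖ ≤ K * δ := by
  set c := ((segMeasure B univ) ^ ((1 : ℝ) / 2)).toReal with hc
  set M := (measureUnivNNReal (segMeasure B) : ℝ) ^ (2 : ENNReal).toReal⁻¹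
  refine ⟨M * c, fun δ hδ => ?_⟩
  refine ContinuousLinearMap.opNorm_le_bound _ (by positivity) fun f => ?_
  refine (Lp.norm_le_of_ae_bound (C := δ * (c * ‖f‖)) (by positivity) ?_).trans
    (le_of_eq (by ring))
  rw [sub_apply]
  filter_upwards [Lp.coeFn_sub (callOp B f) (sampledCallOp B δ f), callOp_ae_eq f,
    sampledCallOp_ae_eq hδ f, ae_restrict_mem measurableSet_Icc] with ξ h1 h2 h3 hξ
  rw [h1, Pi.sub_apply, h2, h3, ← integral_sub
    (integrable_kernel_mul continuous_uncurry_callKernel (integrable_L2Seg f))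
    (integrable_kernel_mul continuous_uncurry_callKernel (integrable_L2Seg f))]
  calc _ ≤ ∫ x in Icc 0 B, δ * |f x| := by
        refine norm_integral_le_of_norm_le ((integrable_L2Seg f).abs.const_mul δ)
          (Eventually.of_forall fun x => ?_)
        rw [← sub_mul, norm_mul]
        refine mul_le_mul_of_nonneg_right ((abs_callKernel_sub_le _ _ _).trans ?_) (abs_nonneg _)
        have h4 := Nat.floor_le (div_nonneg hξ.1 hδ.le)
        have h5 := Nat.lt_floor_add_one (ξ / δ)
        rw [le_div_iff₀ hδ] at h4
        rw [div_lt_iff₀ hδ] at h5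
        rw [abs_of_nonneg (by linarith)]
        linarith
    _ = δ * ∫ x in Icc 0 B, |f x| := integral_const_mul _ _
    _ ≤ _ := mul_le_mul_of_nonneg_left (integral_abs_L2Seg_le f) hδ.le

theorem isCompactOperator_callOp (B : ℝ) : IsCompactOperator (callOp B) := by
  obtain ⟨K, hK⟩ := norm_callOp_sub_sampledCallOp_le B
  have ht : Tendsto (fun δ => sampledCallOp B δ) (𝓝[>] 0) (𝓝 (callOp B)) := by
    rw [tendsto_iff_norm_sub_tendsto_zero]
    have h0 : Tendsto (fun δ : ℝ => K * δ) (𝓝[>] 0) (𝓝 0) := by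
      have : Tendsto (fun δ : ℝ => K * δ) (𝓝 0) (𝓝 (K * 0)) := tendsto_id.const_mul K
      rw [mul_zero] at this
      exact this.mono_left nhdsWithin_le_nhds
    refine squeeze_zero' (Eventually.of_forall fun _ => norm_nonneg _) ?_ h0
    filter_upwards [self_mem_nhdsWithin] with δ hδ
    rw [norm_sub_rev]
    exact hK δ hδ
  exact isCompactOperator_of_tendsto ht
    (Eventually.of_forall fun δ => isCompactOperator_sampledCallOp B δ)

theorem isCompactOperator_putCallOp (B : ℝ) : IsCompactOperator (putCallOp B) :=
  (isCompactOperator_callOp B).clm_comp (putOp B)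

theorem isCompactOperator_callPutOp (B : ℝ) : IsCompactOperator (callPutOp B) :=
  (isCompactOperator_callOp B).comp_clm (putOp B)

end Compact

/-! ### Chains of derivatives and absolute continuity -/

section IteratedDeriv

variable {s : Set ℝ} {G : ℕ → ℝ → ℝ} {n : ℕ}

theorem eqOn_iteratedDerivWithin_of_hasDerivWithinAt (hs : UniqueDiffOn ℝ s)
    (h : ∀ i < n, ∀ x ∈ s, HasDerivWithinAt (G i) (G (i + 1) x) s x) :
    ∀ i ≤ n, EqOn (iteratedDerivWithin i (G 0) s) (G i) s := by
  intro i
  induction i with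
  | zero => intro _ x _; rw [iteratedDerivWithin_zero]
  | succ i ih =>
    intro hi x hx
    rw [iteratedDerivWithin_succ, derivWithin_congr (ih (by omega)) (ih (by omega) hx)]
    exact (h i (by omega) x hx).derivWithin (hs x hx)

theorem contDiffOn_of_hasDerivWithinAt (hs : UniqueDiffOn ℝ s)
    (h : ∀ i < n, ∀ x ∈ s, HasDerivWithinAt (G i) (G (i + 1) x) s x)
    (hn : ContinuousOn (G n) s) : ContDiffOn ℝ n (G 0) s := by
  rw [contDiffOn_nat_iff_continuousOn_differentiableOn_deriv hs]
  have he := eqOn_iteratedDerivWithin_of_hasDerivWithinAt hs h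
  constructor
  · intro m hm
    rw [continuousOn_congr (he m hm)]
    rcases hm.lt_or_eq with hm | rfl
    · exact fun x hx => (h m hm x hx).continuousWithinAt
    · exact hn
  · intro m hm x hx
    exact (h m hm x hx).differentiableWithinAt.congr (he m hm.le) (he m hm.le hx)

theorem eqOn_iteratedDerivWithin_congr {f g : ℝ → ℝ} (h : EqOn f g s) (n : ℕ) :
    EqOn (iteratedDerivWithin n f s) (iteratedDerivWithin n g s) s := by
  induction n with
  | zero => simpa only [iteratedDerivWithin_zero] using h
  | succ n ih =>
    intro x hx
    rw [iteratedDerivWithin_succ, iteratedDerivWithin_succ]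
    exact derivWithin_congr ih (ih hx)

end IteratedDeriv

theorem AbsolutelyContinuousOnInterval.congr {f g : ℝ → ℝ} {a b : ℝ}
    (hf : AbsolutelyContinuousOnInterval f a b) (h : EqOn g f (uIcc a b)) :
    AbsolutelyContinuousOnInterval g a b := by
  rw [absolutelyContinuousOnInterval_iff] at hf ⊢
  intro ε hε
  obtain ⟨δ, hδ, H⟩ := hf ε hε
  refine ⟨δ, hδ, fun E hE hs => ?_⟩
  refine lt_of_eq_of_lt (Finset.sum_congr rfl fun i hi => ?_) (H E hE hs)
  rw [h (hE.1 i hi).1, h (hE.1 i hi).2]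

/-! ### The fourth derivative in `L²[0, B]` -/

section FourthDeriv

variable {B : ℝ} {f g h h' : L2Seg B}

theorem intervalIntegrable_L2Seg (hB : 0 < B) (f : L2Seg B) :
    IntervalIntegrable f volume 0 B :=
  (intervalIntegrable_iff_integrableOn_Icc_of_le hB.le).2 (integrable_L2Seg f)

/-- An indefinite integral of an integrable function is absolutely continuous, and Lebesgue
differentiation recovers the integrand almost everywhere. -/
theorem hasFourthDeriv_of_chain (hB : 0 < B) {G : ℕ → ℝ → ℝ} {c : ℝ}
    (hG : ∀ i < 3, ∀ x ∈ Icc 0 B, HasDerivWithinAt (G i) (G (i + 1) x) (Icc 0 B) x)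
    (h3 : ∀ x ∈ Icc 0 B, G 3 x = c + ∫ t in 0..x, f t) (hg : g =ᵐ[segMeasure B] G 0) :
    HasFourthDeriv B g f := by
  have hu := uniqueDiffOn_Icc hB
  have hi := intervalIntegrable_L2Seg hB f
  have he : EqOn (iteratedDerivWithin 3 (G 0) (Icc 0 B)) (fun x => c + ∫ t in 0..x, f t)
      (Icc 0 B) := fun x hx =>
    (eqOn_iteratedDerivWithin_of_hasDerivWithinAt hu hG 3 le_rfl hx).trans (h3 x hx)
  have hac : AbsolutelyContinuousOnInterval (fun x => c + ∫ t in 0..x, f t) 0 B :=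
    (contDiffOn_const (c := c)).absolutelyContinuousOnInterval.add
      (hi.absolutelyContinuousOnInterval_intervalIntegral left_mem_uIcc)
  refine ⟨G 0, hg, ?_, hac.congr (by rwa [uIcc_of_le hB.le]), ?_⟩
  · refine contDiffOn_of_hasDerivWithinAt (n := 3) hu hG ?_
    have hc := hac.continuousOn
    rw [uIcc_of_le hB.le] at hc
    exact hc.congr h3
  · filter_upwards [ae_restrict_of_ae hi.ae_hasDerivAt_integral,
      ae_restrict_mem measurableSet_Icc] with x hx hm
    rw [uIcc_of_le hB.le] at hx
    exact ((hx hm 0 (left_mem_Icc.2 hB.le)).const_add c).hasDerivWithinAt.congr he (he hm)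

theorem hasContDiffRep_four_of_chain (hB : 0 < B) {G : ℕ → ℝ → ℝ} {c : ℝ}
    (hG : ∀ i < 3, ∀ x ∈ Icc 0 B, HasDerivWithinAt (G i) (G (i + 1) x) (Icc 0 B) x)
    (h3 : ∀ x ∈ Icc 0 B, G 3 x = c + ∫ t in 0..x, f t) (hg : g =ᵐ[segMeasure B] G 0)
    (hf : HasContDiffRep B 0 f) : HasContDiffRep B 4 g := by
  obtain ⟨F, hF, hFc⟩ := hf
  have hFc : ContinuousOn F (Icc 0 B) := by simpa using hFc
  -- Extending the continuous representative by constants beyond the segment gives the fundamental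
  -- theorem of calculus at every point, end points included.
  let F' : ℝ → ℝ := IccExtend hB.le ((Icc 0 B).domRestrict F)
  have hF'c : Continuous F' := (continuousOn_iff_continuous_domRestrict.1 hFc).Icc_extend'
  have hF' : EqOn F' F (Icc 0 B) := fun x hx => IccExtend_of_mem _ _ hx
  have h3' : ∀ x ∈ Icc 0 B, G 3 x = c + ∫ t in 0..x, F' t := by
    intro x hx
    rw [h3 x hx]
    congr 1
    refine intervalIntegral.integral_congr_ae ?_
    have h := (ae_restrict_iff' measurableSet_Icc).1 hF
    filter_upwards [h] with t ht htm
    rw [uIoc_of_le hx.1] at htm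
    have hm : t ∈ Icc 0 B := ⟨htm.1.le, htm.2.trans hx.2⟩
    rw [ht hm, hF' hm]
  let G' : ℕ → ℝ → ℝ := fun i => if i < 4 then G i else F'
  refine ⟨G' 0, hg, ?_⟩
  refine contDiffOn_of_hasDerivWithinAt (n := 4) (uniqueDiffOn_Icc hB) ?_ hF'c.continuousOn
  intro i hi x hx
  rcases Nat.lt_succ_iff_lt_or_eq.1 hi with hi | rfl
  · have h1 : G' i = G i := if_pos (by omega)
    have h2 : G' (i + 1) = G (i + 1) := if_pos (by omega)
    rw [h1, h2]
    exact hG i hi x hx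
  · have hd : HasDerivAt (fun x => c + ∫ t in 0..x, F' t) (F' x) x :=
      (hF'c.integral_hasStrictDerivAt 0 x).hasDerivAt.const_add c
    exact hd.hasDerivWithinAt.congr h3' (h3' x hx)

theorem eqOn_of_ae_eq_Icc (hB : 0 < B) {F G : ℝ → ℝ} (h : F =ᵐ[segMeasure B] G)
    (hF : ContinuousOn F (Icc 0 B)) (hG : ContinuousOn G (Icc 0 B)) : EqOn F G (Icc 0 B) :=
  Measure.eqOn_Icc_of_ae_eq volume hB.ne h hF hG

/-- Continuous representatives that agree almost everywhere agree on all of `[0, B]`, so their third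
derivatives coincide too. -/
theorem HasFourthDeriv.unique (hB : 0 < B) (h1 : HasFourthDeriv B g h)
    (h2 : HasFourthDeriv B g h') : h = h' := by
  obtain ⟨G, hG, hGc, -, hGd⟩ := h1
  obtain ⟨K, hK, hKc, -, hKd⟩ := h2
  have he := eqOn_iteratedDerivWithin_congr
    (eqOn_of_ae_eq_Icc hB (hG.symm.trans hK) hGc.continuousOn hKc.continuousOn) 3
  refine Lp.ext ?_
  filter_upwards [hGd, hKd, ae_restrict_mem measurableSet_Icc] with x hx hx' hm
  exact (uniqueDiffOn_Icc hB x hm).eq_deriv _ hx (hx'.congr he (he hm))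

theorem HasFourthDeriv.hasContDiffRep_zero (hB : 0 < B) (h1 : HasFourthDeriv B g h)
    (h2 : HasContDiffRep B 4 g) : HasContDiffRep B 0 h := by
  obtain ⟨G, hG, hGc, -, hGd⟩ := h1
  obtain ⟨K, hK, hKc⟩ := h2
  have hu := uniqueDiffOn_Icc hB
  have he := eqOn_iteratedDerivWithin_congr
    (eqOn_of_ae_eq_Icc hB (hG.symm.trans hK) hGc.continuousOn hKc.continuousOn) 3
  refine ⟨iteratedDerivWithin 4 K (Icc 0 B), ?_, ?_⟩
  · filter_upwards [hGd, ae_restrict_mem measurableSet_Icc] with x hx hm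
    rw [iteratedDerivWithin_succ, ← derivWithin_congr he (he hm), hx.derivWithin (hu x hm)]
  · have hc := hKc.continuousOn_iteratedDerivWithin (m := 4) (by norm_num) hu
    simpa using hc

theorem HasFourthDeriv.hasContDiffRep_of_fourthDeriv (h1 : HasFourthDeriv B g h) :
    HasContDiffRep B 0 g := by
  obtain ⟨G, hG, hGc, -, -⟩ := h1
  exact ⟨G, hG, by simpa using hGc.continuousOn⟩

theorem HasContDiffRep.const_smul {n : ℕ} (hg : HasContDiffRep B n g) (c : ℝ) :
    HasContDiffRep B n (c • g) := by
  obtain ⟨G, hG, hGc⟩ := hg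
  refine ⟨fun x => c * G x, ?_, contDiffOn_const.mul hGc⟩
  filter_upwards [Lp.coeFn_smul c g, hG] with x h1 h2
  rw [h1, Pi.smul_apply, h2, smul_eq_mul]

end FourthDeriv

/-! ### Differentiating the integral formulas -/

section Primitive

variable {B : ℝ} {f : ℝ → ℝ}

theorem abs_putKernel_sub_le (ξ ξ' x : ℝ) : |putKernel ξ x - putKernel ξ' x| ≤ |ξ - ξ'| := by
  refine (abs_max_sub_max_le_abs _ _ _).trans (le_of_eq ?_)
  congr 1
  ring

theorem hasDerivAt_putKernel {ξ x : ℝ} (h : x ≠ ξ) :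
    HasDerivAt (fun ξ => putKernel ξ x) (if x < ξ then 1 else 0) ξ := by
  rcases h.lt_or_gt with h | h
  · rw [if_pos h]
    refine ((hasDerivAt_id ξ).sub_const x).congr_of_eventuallyEq ?_
    filter_upwards [Ioi_mem_nhds h] with y hy
    exact max_eq_left (sub_nonneg.2 (le_of_lt hy))
  · rw [if_neg h.not_gt]
    refine (hasDerivAt_const ξ (0 : ℝ)).congr_of_eventuallyEq ?_
    filter_upwards [Iio_mem_nhds h] with y hy
    exact max_eq_right (sub_nonpos.2 (le_of_lt hy))

theorem hasDerivAt_callKernel {ξ x : ℝ} (h : x ≠ ξ) :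
    HasDerivAt (fun ξ => callKernel ξ x) (if ξ < x then -1 else 0) ξ := by
  rcases h.lt_or_gt with h | h
  · rw [if_neg h.not_gt]
    refine (hasDerivAt_const ξ (0 : ℝ)).congr_of_eventuallyEq ?_
    filter_upwards [Ioi_mem_nhds h] with y hy
    exact max_eq_right (sub_nonpos.2 (le_of_lt hy))
  · rw [if_pos h]
    refine ((hasDerivAt_id ξ).const_sub x).congr_of_eventuallyEq ?_
    filter_upwards [Iio_mem_nhds h] with y hy
    exact max_eq_left (sub_nonneg.2 (le_of_lt hy))

/-- The kernel has its kink only at `x = ξ`, a null set, and its Lipschitz bound makes `|f|` a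
dominating function. -/
theorem hasDerivAt_integral_kernel_mul {k : ℝ → ℝ → ℝ} {d : ℝ → ℝ} {ξ : ℝ}
    (hk : Continuous (Function.uncurry k)) (hL : ∀ y z x, |k y x - k z x| ≤ |y - z|)
    (hd : Measurable d) (hkd : ∀ x ≠ ξ, HasDerivAt (fun y => k y x) (d x) ξ)
    (hf : Integrable f (segMeasure B)) :
    HasDerivAt (fun y => ∫ x in Icc 0 B, k y x * f x) (∫ x in Icc 0 B, d x * f x) ξ := by
  refine (hasDerivAt_integral_of_dominated_loc_of_lip (bound := fun x => |f x|) univ_mem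
    (Eventually.of_forall fun y => (integrable_kernel_mul hk hf).aestronglyMeasurable)
    (integrable_kernel_mul hk hf) (hd.aestronglyMeasurable.mul hf.aestronglyMeasurable)
    (Eventually.of_forall fun x => ?_) hf.abs ?_).2
  · refine LipschitzOnWith.of_dist_le_mul fun y _ z _ => ?_
    rw [Real.dist_eq, Real.dist_eq, ← sub_mul, abs_mul, mul_comm]
    simpa using mul_le_mul_of_nonneg_left (hL y z x) (abs_nonneg (f x))
  · have h : ∀ᵐ x ∂(segMeasure B), x ≠ ξ := ae_restrict_of_ae (by simp [ae_iff])
    filter_upwards [h] with x hx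
    exact (hkd x hx).mul_const (f x)

theorem hasDerivAt_putFun (hf : Integrable f (segMeasure B)) {ξ : ℝ} (hξ : ξ ∈ Icc 0 B) :
    HasDerivAt (fun y => ∫ x in Icc 0 B, putKernel y x * f x) (∫ x in 0..ξ, f x) ξ := by
  have h := hasDerivAt_integral_kernel_mul (d := fun x => if x < ξ then 1 else 0)
    continuous_putKernel abs_putKernel_sub_le
    (Measurable.ite measurableSet_Iio measurable_const measurable_const)
    (fun x hx => hasDerivAt_putKernel hx) hf
  convert h using 1
  have he : (fun x => (if x < ξ then 1 else 0) * f x) = (Iio ξ).indicator f := by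
    ext x
    by_cases hx : x < ξ <;> simp [hx]
  rw [he, setIntegral_indicator measurableSet_Iio, intervalIntegral.integral_of_le hξ.1,
    ← integral_Ico_eq_integral_Ioc]
  congr 2
  ext x
  simp only [mem_Ico, mem_inter_iff, mem_Icc, mem_Iio]
  exact ⟨fun h => ⟨⟨h.1, h.2.le.trans hξ.2⟩, h.2⟩, fun h => ⟨h.1.1, h.2⟩⟩

theorem hasDerivAt_callFun (hf : Integrable f (segMeasure B)) {ξ : ℝ} (hξ : ξ ∈ Icc 0 B) :
    HasDerivAt (fun y => ∫ x in Icc 0 B, callKernel y x * f x) (-∫ x in ξ..B, f x) ξ := by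
  have h := hasDerivAt_integral_kernel_mul (d := fun x => if ξ < x then -1 else 0)
    continuous_uncurry_callKernel abs_callKernel_sub_le
    (Measurable.ite measurableSet_Ioi measurable_const measurable_const)
    (fun x hx => hasDerivAt_callKernel hx) hf
  convert h using 1
  have he : (fun x => (if ξ < x then -1 else 0) * f x) = (Ioi ξ).indicator (fun x => -f x) := by
    ext x
    by_cases hx : ξ < x <;> simp [hx]
  rw [he, setIntegral_indicator measurableSet_Ioi, intervalIntegral.integral_of_le hξ.2,
    ← integral_neg]
  congr 2
  ext x
  simp only [mem_Ioc, mem_inter_iff, mem_Icc, mem_Ioi]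
  exact ⟨fun h => ⟨⟨hξ.1.trans h.1.le, h.2⟩, h.1⟩, fun h => ⟨h.2, h.1.2⟩⟩

theorem continuous_integral_kernel_mul {k : ℝ → ℝ → ℝ}
    (hk : Continuous (Function.uncurry k)) (hL : ∀ y z x, |k y x - k z x| ≤ |y - z|)
    (hf : Integrable f (segMeasure B)) :
    Continuous (fun y => ∫ x in Icc 0 B, k y x * f x) := by
  have hlip : LipschitzWith (Real.nnabs (∫ x in Icc 0 B, |f x|))
      (fun y => ∫ x in Icc 0 B, k y x * f x) := by
    have h0 : 0 ≤ ∫ x in Icc 0 B, |f x| := integral_nonneg fun x => abs_nonneg (f x)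
    refine LipschitzWith.of_dist_le_mul fun y z => ?_
    rw [Real.dist_eq, Real.dist_eq, ← integral_sub (integrable_kernel_mul hk hf)
      (integrable_kernel_mul hk hf), Real.coe_nnabs,
      abs_of_nonneg h0, ← integral_mul_const]
    refine norm_integral_le_of_norm_le (G := ℝ) (hf.abs.mul_const _)
      (Eventually.of_forall fun x => ?_)
    rw [← sub_mul, norm_mul, mul_comm]
    exact mul_le_mul_of_nonneg_left (hL y z x) (abs_nonneg _)
  exact hlip.continuous

theorem continuous_putFun (hf : Integrable f (segMeasure B)) :
    Continuous (fun y => ∫ x in Icc 0 B, putKernel y x * f x) :=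
  continuous_integral_kernel_mul continuous_putKernel abs_putKernel_sub_le hf

theorem continuous_callFun (hf : Integrable f (segMeasure B)) :
    Continuous (fun y => ∫ x in Icc 0 B, callKernel y x * f x) :=
  continuous_integral_kernel_mul continuous_uncurry_callKernel abs_callKernel_sub_le hf

/-- The successive derivatives, of order zero to three, of the representative of `γ*γf`. -/
noncomputable def putCallDeriv (B : ℝ) (f : ℝ → ℝ) : ℕ → ℝ → ℝ
  | 0 => fun ξ => ∫ u in Icc 0 B, putKernel ξ u * ∫ x in Icc 0 B, callKernel u x * f x
  | 1 => fun ξ => ∫ u in 0..ξ, ∫ x in Icc 0 B, callKernel u x * f x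
  | 2 => fun ξ => ∫ x in Icc 0 B, callKernel ξ x * f x
  | _ + 3 => fun ξ => -∫ x in ξ..B, f x

/-- The successive derivatives, of order zero to three, of the representative of `γγ*f`. -/
noncomputable def callPutDeriv (B : ℝ) (f : ℝ → ℝ) : ℕ → ℝ → ℝ
  | 0 => fun ξ => ∫ u in Icc 0 B, callKernel ξ u * ∫ x in Icc 0 B, putKernel u x * f x
  | 1 => fun ξ => -∫ u in ξ..B, ∫ x in Icc 0 B, putKernel u x * f x
  | 2 => fun ξ => ∫ x in Icc 0 B, putKernel ξ x * f x
  | _ + 3 => fun ξ => ∫ x in 0..ξ, f x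

theorem integrable_of_continuous (B : ℝ) {g : ℝ → ℝ} (hg : Continuous g) :
    Integrable g (segMeasure B) :=
  hg.continuousOn.integrableOn_compact isCompact_Icc

theorem hasDerivWithinAt_putCallDeriv (hf : Integrable f (segMeasure B)) :
    ∀ i < 3, ∀ x ∈ Icc 0 B,
      HasDerivWithinAt (putCallDeriv B f i) (putCallDeriv B f (i + 1) x) (Icc 0 B) x := by
  intro i hi x hx
  have hc := continuous_callFun hf
  refine HasDerivAt.hasDerivWithinAt ?_
  interval_cases i
  · exact hasDerivAt_putFun (integrable_of_continuous B hc) hx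
  · exact (hc.integral_hasStrictDerivAt 0 x).hasDerivAt
  · exact hasDerivAt_callFun hf hx

theorem hasDerivWithinAt_callPutDeriv (hf : Integrable f (segMeasure B)) :
    ∀ i < 3, ∀ x ∈ Icc 0 B,
      HasDerivWithinAt (callPutDeriv B f i) (callPutDeriv B f (i + 1) x) (Icc 0 B) x := by
  intro i hi x hx
  have hc := continuous_putFun hf
  refine HasDerivAt.hasDerivWithinAt ?_
  interval_cases i
  · exact hasDerivAt_callFun (integrable_of_continuous B hc) hx
  · have h := (hc.integral_hasStrictDerivAt B x).hasDerivAt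
    refine h.congr_of_eventuallyEq (Eventually.of_forall fun y => ?_)
    exact (intervalIntegral.integral_symm _ _).symm
  · exact hasDerivAt_putFun hf hx

end Primitive

/-! ### Regularity, injectivity and dense range -/

section Regularity

variable {B : ℝ} {h g : L2Seg B}

theorem putCallDeriv_three (hB : 0 < B) (f : L2Seg B) : ∀ x ∈ Icc 0 B,
    putCallDeriv B f 3 x = -(∫ t in 0..B, f t) + ∫ t in 0..x, f t := by
  intro x hx
  have hi := intervalIntegrable_L2Seg hB f
  have h1 : IntervalIntegrable f volume 0 x := hi.mono_set (by
    rw [uIcc_of_le hx.1, uIcc_of_le hB.le]; exact Icc_subset_Icc_right hx.2)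
  have h2 : IntervalIntegrable f volume x B := hi.mono_set (by
    rw [uIcc_of_le hx.2, uIcc_of_le hB.le]; exact Icc_subset_Icc_left hx.1)
  rw [← intervalIntegral.integral_add_adjacent_intervals h1 h2, putCallDeriv]
  ring

theorem callPutDeriv_three (f : L2Seg B) : ∀ x ∈ Icc 0 B,
    callPutDeriv B f 3 x = 0 + ∫ t in 0..x, f t := fun x _ => by rw [zero_add, callPutDeriv]

theorem hasFourthDeriv_putCallOp (hB : 0 < B) (f : L2Seg B) :
    HasFourthDeriv B (putCallOp B f) f :=
  hasFourthDeriv_of_chain hB (hasDerivWithinAt_putCallDeriv (integrable_L2Seg f))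
    (putCallDeriv_three hB f) (putCallOp_ae_eq_putFun f)

theorem hasFourthDeriv_callPutOp (hB : 0 < B) (f : L2Seg B) :
    HasFourthDeriv B (callPutOp B f) f :=
  hasFourthDeriv_of_chain hB (hasDerivWithinAt_callPutDeriv (integrable_L2Seg f))
    (callPutDeriv_three f) (callPutOp_ae_eq_callFun f)

theorem hasContDiffRep_four_putCallOp_iff (hB : 0 < B) (f : L2Seg B) :
    HasContDiffRep B 4 (putCallOp B f) ↔ HasContDiffRep B 0 f :=
  ⟨(hasFourthDeriv_putCallOp hB f).hasContDiffRep_zero hB,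
    hasContDiffRep_four_of_chain hB (hasDerivWithinAt_putCallDeriv (integrable_L2Seg f))
      (putCallDeriv_three hB f) (putCallOp_ae_eq_putFun f)⟩

theorem hasContDiffRep_four_callPutOp_iff (hB : 0 < B) (f : L2Seg B) :
    HasContDiffRep B 4 (callPutOp B f) ↔ HasContDiffRep B 0 f :=
  ⟨(hasFourthDeriv_callPutOp hB f).hasContDiffRep_zero hB,
    hasContDiffRep_four_of_chain hB (hasDerivWithinAt_callPutDeriv (integrable_L2Seg f))
      (callPutDeriv_three f) (callPutOp_ae_eq_callFun f)⟩

/-- A bounded operator on `L²[0, B]` which is inverted by the fourth derivative is injective. -/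
theorem ker_eq_bot_of_hasFourthDeriv (hB : 0 < B) {T : L2Seg B →L[ℝ] L2Seg B}
    (hT : ∀ f, HasFourthDeriv B (T f) f) : T.ker = ⊥ := by
  rw [LinearMap.ker_eq_bot']
  intro f hf
  have h1 := hT f
  have h2 := hT 0
  rw [map_zero] at h2
  have hf' : T f = 0 := hf
  rw [hf'] at h1
  exact h1.unique hB h2

theorem hasFourthDeriv_iff_eq (hB : 0 < B) {T : L2Seg B →L[ℝ] L2Seg B}
    (hT : ∀ f, HasFourthDeriv B (T f) f) (f h : L2Seg B) : HasFourthDeriv B (T f) h ↔ h = f :=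
  ⟨fun H => H.unique hB (hT f), fun H => H ▸ hT f⟩

theorem apply_eq_of_hasFourthDeriv (hB : 0 < B) {T : L2Seg B →L[ℝ] L2Seg B}
    (hT : ∀ f, HasFourthDeriv B (T f) f) (hg : g ∈ T.range) (H : HasFourthDeriv B g h) :
    T h = g := by
  obtain ⟨f, rfl⟩ := hg
  rw [(hasFourthDeriv_iff_eq hB hT f h).1 H]
  rfl

/-- Bootstrap: `g = μ⁻¹ T g` is continuous because it lies in the range of `T`, and then `T g` is
`C⁴`. -/
theorem hasContDiffRep_four_of_eigenvector {T : L2Seg B →L[ℝ] L2Seg B}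
    (hT : ∀ f, HasFourthDeriv B (T f) f)
    (hT4 : ∀ f, HasContDiffRep B 0 f → HasContDiffRep B 4 (T f)) {μ : ℝ} (hμ : μ ≠ 0)
    (hg : T g = μ • g) : HasContDiffRep B 4 g := by
  have e : g = μ⁻¹ • T g := by rw [hg, inv_smul_smul₀ hμ]
  have h0 : HasContDiffRep B 0 g := by
    have := (hT g).hasContDiffRep_of_fourthDeriv.const_smul μ⁻¹
    rwa [← e] at this
  have := (hT4 g h0).const_smul μ⁻¹
  rwa [← e] at this

theorem IsSelfAdjoint.topologicalClosure_range_eq_top {H : Type*} [NormedAddCommGroup H]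
    [InnerProductSpace ℝ H] [CompleteSpace H] {T : H →L[ℝ] H} (hT : IsSelfAdjoint T)
    (hk : T.ker = ⊥) : T.range.topologicalClosure = ⊤ := by
  rw [Submodule.topologicalClosure_eq_top_iff, ContinuousLinearMap.orthogonal_range,
    hT.adjoint_eq, hk]

/-- In finite dimension the injective `γ*γ` would be onto, yet a step function has no continuous
representative. -/
theorem not_finiteDimensional_L2Seg (hB : 0 < B) : ¬ FiniteDimensional ℝ (L2Seg B) := by
  intro hfd
  have hinj : Function.Injective ((putCallOp B : L2Seg B →L[ℝ] L2Seg B) : L2Seg B →ₗ[ℝ] L2Seg B) :=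
    LinearMap.ker_eq_bot.1 (ker_eq_bot_of_hasFourthDeriv hB (hasFourthDeriv_putCallOp hB))
  have hsurj := LinearMap.surjective_of_injective hinj
  obtain ⟨f, hf⟩ := hsurj (indicatorConstLp 2 (μ := segMeasure B) (s := Iio (B / 2))
    measurableSet_Iio (measure_ne_top _ _) (1 : ℝ))
  obtain ⟨G, hG, hGc, -, -⟩ := hasFourthDeriv_putCallOp hB f
  have hf' : putCallOp B f = _ := hf
  rw [hf'] at hG
  have he : G =ᵐ[segMeasure B] (Iio (B / 2)).indicator fun _ => 1 :=
    hG.symm.trans indicatorConstLp_coeFn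
  have hc := hGc.continuousOn
  have hs1 : Icc 0 (B / 2) ⊆ Icc 0 B := Icc_subset_Icc_right (by linarith)
  have hs2 : Icc (B / 2) B ⊆ Icc 0 B := Icc_subset_Icc_left (by linarith)
  have h1 : EqOn G (fun _ => 1) (Icc 0 (B / 2)) := by
    refine Measure.eqOn_Icc_of_ae_eq volume (by linarith) ?_ (hc.mono hs1) continuousOn_const
    have hne : ∀ᵐ x ∂(volume.restrict (Icc 0 (B / 2))), x ≠ B / 2 :=
      ae_restrict_of_ae (by simp [ae_iff])
    filter_upwards [ae_restrict_of_ae_restrict_of_subset hs1 he, hne,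
      ae_restrict_mem measurableSet_Icc] with x hx hx' hm
    rw [hx, indicator_of_mem]
    exact lt_of_le_of_ne hm.2 hx'
  have h2 : EqOn G (fun _ => 0) (Icc (B / 2) B) := by
    refine Measure.eqOn_Icc_of_ae_eq volume (by linarith) ?_ (hc.mono hs2) continuousOn_const
    filter_upwards [ae_restrict_of_ae_restrict_of_subset hs2 he,
      ae_restrict_mem measurableSet_Icc] with x hx hm
    rw [hx, indicator_of_notMem]
    exact not_lt.2 hm.1
  have e1 := h1 (right_mem_Icc.2 (by linarith))
  have e2 := h2 (left_mem_Icc.2 (by linarith))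
  rw [e2] at e1
  exact zero_ne_one e1

end Regularity

/-! ### Simplicity of the eigenvalues and the singular system -/

section Spectrum

variable {B : ℝ}

/-- The condition at `B` overdetermines the beam problem: the monotone quantity `E` vanishes at both
end points, so its derivative, minus a sum of squares, vanishes throughout. -/
theorem eq_zero_of_putCallOp_eigenvector (hB : 0 < B) {μ : ℝ} (hμ : 0 < μ) {f : L2Seg B}
    (hf : putCallOp B f = μ • f) (hend : putCallDeriv B f 0 B = 0) : f = 0 := by
  set P := putCallDeriv B f with hP
  have hi := integrable_L2Seg f
  have hP0 : Continuous (P 0) :=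
    continuous_putFun (integrable_of_continuous B (continuous_callFun hi))
  have hae : f =ᵐ[segMeasure B] fun x => P 0 x / μ := by
    have h1 := putCallOp_ae_eq_putFun f
    rw [hf] at h1
    filter_upwards [h1, Lp.coeFn_smul μ f] with x hx hx'
    rw [hx', Pi.smul_apply, smul_eq_mul] at hx
    change f x = putCallDeriv B f 0 x / μ
    rw [eq_div_iff hμ.ne', mul_comm, hx, putCallDeriv]
  have hd := hasDerivWithinAt_putCallDeriv hi
  rw [← hP] at hd
  have hd3 : ∀ x ∈ Icc 0 B, HasDerivWithinAt (P 3) (P 0 x / μ) (Icc 0 B) x := by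
    have h3 : ∀ x ∈ Icc 0 B, P 3 x = -(∫ t in 0..B, f t) + ∫ t in 0..x, P 0 t / μ := by
      intro x hx
      rw [hP, putCallDeriv_three hB f x hx, ← hP]
      congr 1
      refine intervalIntegral.integral_congr_ae ?_
      filter_upwards [(ae_restrict_iff' measurableSet_Icc).1 hae] with t ht htm
      rw [uIoc_of_le hx.1] at htm
      exact ht ⟨htm.1.le, htm.2.trans hx.2⟩
    intro x hx
    have h : HasDerivAt (fun x => -(∫ t in 0..B, f t) + ∫ t in 0..x, P 0 t / μ) (P 0 x / μ) x :=
      ((hP0.div_const μ).integral_hasStrictDerivAt 0 x).hasDerivAt.const_add _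
    exact h.hasDerivWithinAt.congr h3 (h3 x hx)
  -- `E` collects the boundary terms from integrating `t u' (u'''' - u / μ) = 0` by parts, with `u =
  -- P 0`.
  let E : ℝ → ℝ := fun t =>
    t * (P 1 t * P 3 t) - P 1 t * P 2 t - t * (P 2 t ^ 2 / 2) - t * (P 0 t ^ 2 / (2 * μ))
  have hE : ∀ t ∈ Icc 0 B, HasDerivWithinAt E (-(3 / 2 * P 2 t ^ 2 + P 0 t ^ 2 / (2 * μ)))
      (Icc 0 B) t := by
    intro t ht
    have d0 := hd 0 (by norm_num) t ht
    have d1 := hd 1 (by norm_num) t ht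
    have d2 := hd 2 (by norm_num) t ht
    have d3 := hd3 t ht
    have dt := hasDerivWithinAt_id t (Icc 0 B)
    have h := (((dt.mul (d1.mul d3)).sub (d1.mul d2)).sub (dt.mul ((d2.pow 2).div_const 2))).sub
      (dt.mul ((d0.pow 2).div_const (2 * μ)))
    refine h.congr_deriv ?_
    simp only [Pi.mul_apply, Pi.pow_apply, id]
    field_simp
    ring
  have hEc : ContinuousOn E (Icc 0 B) := fun t ht => (hE t ht).continuousWithinAt
  have hanti : AntitoneOn E (Icc 0 B) := by
    refine antitoneOn_of_hasDerivWithinAt_nonpos (convex_Icc 0 B) hEc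
      (fun t ht => (hE t (interior_subset ht)).mono interior_subset) fun t _ => ?_
    have : 0 ≤ 3 / 2 * P 2 t ^ 2 + P 0 t ^ 2 / (2 * μ) := by positivity
    linarith
  have hE0 : E 0 = 0 := by
    have : P 1 0 = 0 := intervalIntegral.integral_same
    simp [E, this]
  have hEB : E B = 0 := by
    have h2 : P 2 B = 0 := by
      refine setIntegral_eq_zero_of_forall_eq_zero fun x hx => ?_
      rw [callKernel, max_eq_right (sub_nonpos.2 hx.2), zero_mul]
    have h3 : P 3 B = 0 := neg_eq_zero.2 intervalIntegral.integral_same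
    simp [E, h2, h3, hend]
  have hEz : ∀ t ∈ Icc 0 B, E t = 0 := fun t ht => le_antisymm
    (hE0 ▸ hanti (left_mem_Icc.2 hB.le) ht ht.1) (hEB ▸ hanti ht (right_mem_Icc.2 hB.le) ht.2)
  have hPz : ∀ t ∈ Icc 0 B, P 0 t = 0 := by
    intro t ht
    have h1 : HasDerivWithinAt E 0 (Icc 0 B) t :=
      (hasDerivWithinAt_const t (Icc 0 B) (0 : ℝ)).congr hEz (hEz t ht)
    have h2 := (uniqueDiffOn_Icc hB t ht).eq_deriv _ (hE t ht) h1
    have h3 : 0 ≤ 3 / 2 * P 2 t ^ 2 := by positivity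
    have h4 : 0 ≤ P 0 t ^ 2 / (2 * μ) := by positivity
    have h5 : P 0 t ^ 2 / (2 * μ) = 0 := by linarith
    simpa [hμ.ne'] using h5
  rw [Lp.eq_zero_iff_ae_eq_zero]
  filter_upwards [hae, ae_restrict_mem measurableSet_Icc] with x hx hm
  rw [hx, hPz x hm, zero_div, Pi.zero_apply]

theorem memLp_putKernel (B ξ : ℝ) : MemLp (putKernel ξ) 2 (segMeasure B) :=
  memLp_of_continuous B (by unfold putKernel callKernel; fun_prop)

/-- This makes the value at a point a linear functional of the `L²` class. -/
theorem putCallDeriv_zero_eq_inner (f : L2Seg B) (ξ : ℝ) :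
    putCallDeriv B f 0 ξ = inner ℝ ((memLp_putKernel B ξ).toLp _) (callOp B f) := by
  rw [inner_L2Seg, putCallDeriv]
  refine integral_congr_ae ?_
  filter_upwards [(memLp_putKernel B ξ).coeFn_toLp, callOp_ae_eq f] with u h1 h2
  rw [h1, h2]

theorem ker_putCallOp (hB : 0 < B) : (putCallOp B).ker = ⊥ :=
  ker_eq_bot_of_hasFourthDeriv hB (hasFourthDeriv_putCallOp hB)

theorem ker_callPutOp (hB : 0 < B) : (callPutOp B).ker = ⊥ :=
  ker_eq_bot_of_hasFourthDeriv hB (hasFourthDeriv_callPutOp hB)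

theorem inner_putCallOp_self_pos (hB : 0 < B) {f : L2Seg B} (hf : f ≠ 0) :
    0 < inner ℝ (putCallOp B f) f := by
  rw [inner_putCallOp_left, real_inner_self_eq_norm_sq]
  have h : callOp B f ≠ 0 := by
    intro h
    refine hf (LinearMap.ker_eq_bot'.1 (ker_putCallOp hB) f ?_)
    change putOp B (callOp B f) = 0
    rw [h, map_zero]
  positivity

theorem putCallOp_eigenvalue_pos (hB : 0 < B) {f : L2Seg B} (hf : f ≠ 0) {μ : ℝ}
    (h : putCallOp B f = μ • f) : 0 < μ := by
  have hp := inner_putCallOp_self_pos hB hf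
  rw [h, inner_smul_left, real_inner_self_eq_norm_sq] at hp
  exact pos_of_mul_pos_left hp (sq_nonneg _)

/-- The eigenvalues of `γ*γ` are simple. -/
theorem putCallOp_eigenvalue_simple (hB : 0 < B) {μ : ℝ} {f g : L2Seg B} (hf : f ≠ 0)
    (h1 : putCallOp B f = μ • f) (h2 : putCallOp B g = μ • g) : ∃ c : ℝ, g = c • f := by
  have hμ := putCallOp_eigenvalue_pos hB hf h1
  have ha : putCallDeriv B f 0 B ≠ 0 := fun h =>
    hf (eq_zero_of_putCallOp_eigenvector hB hμ h1 h)
  -- The coefficient is chosen so that the eigenvector `g - c • f` has end value zero at `B`.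
  refine ⟨putCallDeriv B g 0 B / putCallDeriv B f 0 B, ?_⟩
  rw [← sub_eq_zero]
  refine eq_zero_of_putCallOp_eigenvector hB hμ ?_ ?_
  · rw [map_sub, map_smul, h1, h2, smul_sub, smul_comm]
  · rw [putCallDeriv_zero_eq_inner, map_sub, map_smul, inner_sub_right, inner_smul_right,
      ← putCallDeriv_zero_eq_inner, ← putCallDeriv_zero_eq_inner, div_mul_cancel₀ _ ha, sub_self]

theorem putOp_injective (hB : 0 < B) {f : L2Seg B} (hf : putOp B f = 0) : f = 0 := by
  refine LinearMap.ker_eq_bot'.1 (ker_callPutOp hB) f ?_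
  change callOp B (putOp B f) = 0
  rw [hf, map_zero]

theorem exists_singular_system (hB : 0 < B) : ∃ (lam : ℕ → ℝ) (φ ψ : ℕ → L2Seg B),
    (∀ k, 0 < lam k) ∧ StrictAnti lam ∧ Orthonormal ℝ φ ∧ Orthonormal ℝ ψ ∧
    (∀ k, putCallOp B (φ k) = (lam k ^ 2) • φ k) ∧
    (∀ k, callPutOp B (ψ k) = (lam k ^ 2) • ψ k) ∧
    (Submodule.span ℝ (range φ)).topologicalClosure = ⊤ ∧
    (Submodule.span ℝ (range ψ)).topologicalClosure = ⊤ := by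
  obtain ⟨μ, φ, hμ, hanti, hon, heig, hd⟩ := exists_orthonormal_eigenvectors
    (isCompactOperator_putCallOp B) (isSelfAdjoint_putCallOp B).isSymmetric
    (fun x hx => inner_putCallOp_self_pos hB hx)
    (fun μ x y hx h1 h2 => putCallOp_eigenvalue_simple hB hx h1 h2)
    (not_finiteDimensional_L2Seg hB)
  have hsq : ∀ k, √(μ k) ^ 2 = μ k := fun k => Real.sq_sqrt (hμ k).le
  have hpos : ∀ k, 0 < √(μ k) := fun k => Real.sqrt_pos.2 (hμ k)
  refine ⟨fun k => √(μ k), φ, fun k => (√(μ k))⁻¹ • callOp B (φ k), hpos,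
    fun i j hij => Real.sqrt_lt_sqrt (hμ j).le (hanti hij), hon, ?_,
    fun k => by rw [hsq, heig], fun k => ?_, hd, ?_⟩
  · rw [orthonormal_iff_ite] at hon ⊢
    intro i j
    rw [inner_smul_left, inner_smul_right, ← inner_putCallOp_left, heig, inner_smul_left, hon]
    split_ifs with hij
    · subst hij
      have := (hpos i).ne'
      simp only [RCLike.conj_to_real]
      -- The third occurrence of `μ i` is the one outside the square roots.
      nth_rewrite 3 [← hsq i]
      field_simp
    · simp
  · change callOp B (putOp B _) = _
    have h : putOp B (callOp B (φ k)) = μ k • φ k := heig k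
    rw [map_smul, map_smul, h, map_smul, smul_comm, hsq]
  -- If `f` is orthogonal to every `γ φ_k`, then `γ* f` is orthogonal to every `φ_k`, hence zero,
  -- and `γ*` is injective.
  · rw [Submodule.topologicalClosure_eq_top_iff, Submodule.eq_bot_iff]
    intro f hf
    refine putOp_injective hB ?_
    rw [Submodule.topologicalClosure_eq_top_iff, Submodule.eq_bot_iff] at hd
    refine hd _ ?_
    rw [Submodule.mem_orthogonal] at hf ⊢
    intro g hg
    induction hg using Submodule.span_induction with
    | mem g hg =>
      obtain ⟨k, rfl⟩ := hg
      have h := hf _ (Submodule.subset_span ⟨k, rfl⟩)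
      rw [inner_smul_left] at h
      rw [putOp, ContinuousLinearMap.adjoint_inner_right]
      simpa [(hpos k).ne'] using h
    | zero => exact inner_zero_left _
    | add x y _ _ hx hy => rw [inner_add_left, hx, hy, add_zero]
    | smul c x _ hx => rw [inner_smul_left, hx, mul_zero]

end Spectrum

/-! ### The main theorem -/

theorem mainTheorem2 (B : ℝ) (hB : 0 < B) :
    -- the adjoint `γ*` is the put operator
    (∀ f : L2Seg B, putOp B f =ᵐ[segMeasure B]
        fun ξ => ∫ x in Icc 0 B, putKernel ξ x * f x) ∧
    -- `γ*γ` and `γγ*` are integral operators with continuous symmetric kernels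
    (∀ f : L2Seg B, putCallOp B f =ᵐ[segMeasure B]
        fun ξ => ∫ x in Icc 0 B, putCallKernel B ξ x * f x) ∧
    (∀ f : L2Seg B, callPutOp B f =ᵐ[segMeasure B]
        fun ξ => ∫ x in Icc 0 B, callPutKernel B ξ x * f x) ∧
    ContinuousOn (fun p : ℝ × ℝ => putCallKernel B p.1 p.2) (Icc 0 B ×ˢ Icc 0 B) ∧
    ContinuousOn (fun p : ℝ × ℝ => callPutKernel B p.1 p.2) (Icc 0 B ×ˢ Icc 0 B) ∧
    (∀ ξ ∈ Icc 0 B, ∀ x ∈ Icc 0 B, putCallKernel B ξ x = putCallKernel B x ξ) ∧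
    (∀ ξ ∈ Icc 0 B, ∀ x ∈ Icc 0 B, callPutKernel B ξ x = callPutKernel B x ξ) ∧
    -- they are compact and self-adjoint
    IsCompactOperator (putCallOp B) ∧ IsSelfAdjoint (putCallOp B) ∧
    IsCompactOperator (callPutOp B) ∧ IsSelfAdjoint (callPutOp B) ∧
    -- regularity of the ranges
    (∀ g ∈ (putCallOp B).range, ∃ h, HasFourthDeriv B g h) ∧
    (∀ g ∈ (callPutOp B).range, ∃ h, HasFourthDeriv B g h) ∧
    (∀ f : L2Seg B, HasContDiffRep B 4 (putCallOp B f) ↔ HasContDiffRep B 0 f) ∧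
    (∀ f : L2Seg B, HasContDiffRep B 4 (callPutOp B f) ↔ HasContDiffRep B 0 f) ∧
    -- trivial null spaces, dense ranges
    (putCallOp B).ker = ⊥ ∧ (callPutOp B).ker = ⊥ ∧
    (putCallOp B).range.topologicalClosure = ⊤ ∧
    (callPutOp B).range.topologicalClosure = ⊤ ∧
    -- the fourth derivative inverts both operators
    (∀ f : L2Seg B, ∀ h, HasFourthDeriv B (putCallOp B f) h ↔ h = f) ∧
    (∀ g ∈ (putCallOp B).range, ∀ h, HasFourthDeriv B g h → putCallOp B h = g) ∧
    (∀ f : L2Seg B, ∀ h, HasFourthDeriv B (callPutOp B f) h ↔ h = f) ∧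
    (∀ g ∈ (callPutOp B).range, ∀ h, HasFourthDeriv B g h → callPutOp B h = g) ∧
    -- common eigenvalues, orthonormal bases of eigenvectors, spectral expansions
    ∃ (lam : ℕ → ℝ) (φ ψ : ℕ → L2Seg B),
      (∀ k, 0 < lam k) ∧ StrictAnti lam ∧
      Orthonormal ℝ φ ∧ Orthonormal ℝ ψ ∧
      (∀ k, putCallOp B (φ k) = (lam k ^ 2) • φ k) ∧
      (∀ k, callPutOp B (ψ k) = (lam k ^ 2) • ψ k) ∧
      (∀ k, HasContDiffRep B 4 (φ k)) ∧ (∀ k, HasContDiffRep B 4 (ψ k)) ∧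
      (Submodule.span ℝ (range φ)).topologicalClosure = (putCallOp B).range.topologicalClosure ∧
      (Submodule.span ℝ (range ψ)).topologicalClosure = (callPutOp B).range.topologicalClosure ∧
      (Submodule.span ℝ (range φ)).topologicalClosure = ⊤ ∧
      (Submodule.span ℝ (range ψ)).topologicalClosure = ⊤ ∧
      (∀ f : L2Seg B, HasSum (fun k => inner ℝ f (φ k) • φ k) f) ∧
      (∀ f : L2Seg B, HasSum (fun k => (lam k ^ 2 * inner ℝ f (φ k)) • φ k) (putCallOp B f)) ∧
      (∀ f : L2Seg B, HasSum (fun k => inner ℝ f (ψ k) • ψ k) f) ∧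
      (∀ f : L2Seg B,
        HasSum (fun k => (lam k ^ 2 * inner ℝ f (ψ k)) • ψ k) (callPutOp B f)) := by
  have hT1 := hasFourthDeriv_putCallOp hB
  have hT2 := hasFourthDeriv_callPutOp hB
  have hr1 := (isSelfAdjoint_putCallOp B).topologicalClosure_range_eq_top (ker_putCallOp hB)
  have hr2 := (isSelfAdjoint_callPutOp B).topologicalClosure_range_eq_top (ker_callPutOp hB)
  refine ⟨putOp_ae_eq, putCallOp_ae_eq, callPutOp_ae_eq,
    (continuous_putCallKernel B).continuousOn, (continuous_callPutKernel B).continuousOn,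
    fun ξ _ x _ => putCallKernel_comm B ξ x, fun ξ _ x _ => callPutKernel_comm B ξ x,
    isCompactOperator_putCallOp B, isSelfAdjoint_putCallOp B,
    isCompactOperator_callPutOp B, isSelfAdjoint_callPutOp B, ?_, ?_,
    hasContDiffRep_four_putCallOp_iff hB, hasContDiffRep_four_callPutOp_iff hB,
    ker_putCallOp hB, ker_callPutOp hB, hr1, hr2,
    hasFourthDeriv_iff_eq hB hT1, fun g hg h H => apply_eq_of_hasFourthDeriv hB hT1 hg H,
    hasFourthDeriv_iff_eq hB hT2, fun g hg h H => apply_eq_of_hasFourthDeriv hB hT2 hg H, ?_⟩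
  · rintro _ ⟨f, rfl⟩
    exact ⟨f, hT1 f⟩
  · rintro _ ⟨f, rfl⟩
    exact ⟨f, hT2 f⟩
  · obtain ⟨lam, φ, ψ, hpos, hanti, hφ, hψ, hTφ, hTψ, hdφ, hdψ⟩ := exists_singular_system hB
    exact ⟨lam, φ, ψ, hpos, hanti, hφ, hψ, hTφ, hTψ,
      fun k => hasContDiffRep_four_of_eigenvector hT1
        (fun f => (hasContDiffRep_four_putCallOp_iff hB f).2) (pow_pos (hpos k) 2).ne' (hTφ k),
      fun k => hasContDiffRep_four_of_eigenvector hT2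
        (fun f => (hasContDiffRep_four_callPutOp_iff hB f).2) (pow_pos (hpos k) 2).ne' (hTψ k),
      hdφ.trans hr1.symm, hdψ.trans hr2.symm, hdφ, hdψ,
      hφ.hasSum_inner_smul hdφ, hφ.hasSum_eigenvector_expansion hdφ hTφ,
      hψ.hasSum_inner_smul hdψ, hψ.hasSum_eigenvector_expansion hdψ hTψ⟩
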